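/- Interferers are initially placed in $\mathbb{R}^2$ as a homogeneous Poisson point process of intensity $\Lambda\in(0,\infty)$. Given their initial positions they move independently of each other, an interferer that starts at $x$ following a random trajectory with law $K(x,\cdot)$, where $K$ is a probability kernel from $\mathbb{R}^2$ to trajectories $[0,\infty)\to\mathbb{R}^2$. The motion preserves homogeneity: for every time $t\ge 0$ and every Borel set $B$, $\int_{\mathbb{R}^2}K(x,\{w: w(t)\in B\})\,dx=|B|$. Let $x_j(t)$ be the position of interferer $j$ at time $t$. Let $l\ge 0$ be a measurable path-loss function on $(0,\infty)$ with $l(r)\to 0$ as $r\to\infty$ and $\int_0^\infty r\,l(r)\,dr<\infty$. A receiver at the origin is served by a transmitter at distance $R>0$, with $l(R)>0$; the noise power is $\gamma\ge 0$. Let $$\mathrm{SINR}_0(t)=\frac{l(R)\,F_0(t)}{\sum_{j\ge1} l(|x_j(t)|)\,F_j(t)+\gamma},$$ which is $+\infty$ if the denominator vanishes and the numerator does not. The fading processes $F_0,F_1,F_2,\dots\ge 0$ are independent of each other and of the motion. For each $j\ge 0$ and $t$, the variables $F_j(t)$ and $F_j(t+1)$ are independent. The variable $F_0(t)$ is exponential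 with mean $1/\mu\in(0,\infty)$ for every $t$ (Rayleigh fading), and the variables $F_j(t)$, $j\ge 1$, $t\ge 0$, have a common arbitrary law on $[0,\infty)$ with mean $1$. Fix a threshold $T\in(0,\infty)$ and let $L_t$ be the event $\{\mathrm{SINR}_0(t)>T\}$. Fix $t\ge 0$ and let $p$ be a probability kernel on $\mathbb{R}^2$ that represents the motion between the times $t$ and $t+1$ ($p(x,B)$ is the probability that a point located at $x$ at time $t$ is in $B$ at time $t+1$), that is, $\int_{\mathbb{R}^2}K(x,\{w:(w(t),w(t+1))\in C\})\,dx=\int_{\mathbb{R}^2}\int_{\mathbb{R}^2} \mathbf 1_C(x,y)\,p(x,dy)\,dx$ for all Borel $C\subseteq\mathbb{R}^2\times\mathbb{R}^2$. Then $$\mathbb{P}(L_{t+1})=\mathbb{P}(L_t).$$ If moreover $\int_{\mathbb{R}^2}\int_{\mathbb{R}^2} l(|x|)\,l(|y|)\,p(x,dy)\,dx>0$ (which always holds if $l>0$ on $(0,\infty)$), then level crossings at times $t$ and $t+1$ are positively correlated: $$\mathbb{P}(L_{t+1}\mid L_t)>\mathbb{P}(L_{t+1})=\mathbb{P}(L_t).$$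 -/

import Mathlib

open MeasureTheory ProbabilityTheory Filter Topology
open scoped NNReal ENNReal

noncomputable section

/-- The plane in which the interferers move, with its Euclidean norm. -/
abbrev Plane : Type := EuclideanSpace ℝ (Fin 2)

/-- Trajectories in the plane, indexed by continuous time `t ≥ 0`. -/
abbrev Trajectory : Type := ℝ≥0 → Plane

/-- `N` is a Poisson point process with intensity measure `ν`, seen as a random counting measure:
counts of sets of finite intensity are Poisson distributed, and counts of pairwise disjoint sets
are independent. -/
structure IsPoissonPointProcess {Ω E : Type*} [MeasurableSpace Ω] [MeasurableSpace E]
    (P : Measure Ω) (N : Ω → Measure E) (ν : Measure E) : Prop where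
  law_count : ∀ B : Set E, MeasurableSet B → ν B ≠ ∞ →
    HasLaw (fun ω => N ω B) ((poissonMeasure (ν B).toNNReal).map (fun n : ℕ => (n : ℝ≥0∞))) P
  indep_count : ∀ (n : ℕ) (B : Fin n → Set E), (∀ i, MeasurableSet (B i)) →
    Pairwise (fun i j => Disjoint (B i) (B j)) → iIndepFun (fun i ω => N ω (B i)) P

/-- An isotropic path-loss function; only its values at distances `r > 0` matter. -/
structure IsPathLoss (l : ℝ → ℝ≥0) : Prop where
  measurable : Measurable l
  tendsto_zero : Tendsto l atTop (𝓝 0)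
  integrable : IntegrableOn (fun r : ℝ => r * (l r : ℝ)) (Set.Ioi 0)

/-- The point process of interferers at time `t`, as a random counting measure; `X j ω s` is the
position of interferer `j` at time `s`. -/
def interfererProcess {Ω : Type*} (X : ℕ → Ω → Trajectory) (t : ℝ≥0) (ω : Ω) : Measure Plane :=
  Measure.sum (fun j => Measure.dirac (X j ω t))

/-- `K x` is the law of the trajectory of an interferer that starts at `x`.  The motion preserves
homogeneity if points that start with uniform density still have that same uniform density at every
later time. -/
def PreservesHomogeneity (K : Kernel Plane Trajectory) : Prop :=
  ∀ t : ℝ≥0, ((volume : Measure Plane).bind K).map (fun w => w t) = volume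

/-- The one-step kernel `p` represents the motion between the times `t` and `t + 1`: `p x B` is the
probability that a point which is at `x` at time `t` is in `B` at time `t + 1`. In other words, the
pairs (position at time `t`, position at time `t + 1`) have mean measure `dx p(x, dy)` per unit
intensity. -/
def RepresentsMotion (K : Kernel Plane Trajectory) (t : ℝ≥0) (p : Kernel Plane Plane) : Prop :=
  ((volume : Measure Plane).bind K).map (fun w => (w t, w (t + 1))) =
    (volume : Measure Plane).compProd p

/-- The mobile network. `X j` is the trajectory of interferer `j`, `F j` the fading process between
interferer `j` and the origin, `G` the fading process of the useful link, `Λ` the intensity of the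
interferers, `K` the motion kernel and `1 / μ` the mean of the fading of the useful link. -/
structure IsMobileNetwork {Ω : Type*} [MeasurableSpace Ω] (P : Measure Ω) (Λ : ℝ≥0)
    (K : Kernel Plane Trajectory) (μ : ℝ) (X : ℕ → Ω → Trajectory)
    (F : ℕ → Ω → ℝ≥0 → ℝ≥0) (G : Ω → ℝ≥0 → ℝ≥0) : Prop where
  measurable_position : ∀ j, Measurable (X j)
  measurable_fading : ∀ j, Measurable (F j)
  measurable_useful : Measurable G
  /-- The initial interferers form a homogeneous Poisson point process of intensity `Λ`. -/
  poisson : IsPoissonPointProcess P (interfererProcess X 0) (Λ • (volume : Measure Plane))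
  /-- Given the initial positions, the interferers move independently of each other, each one
  according to `K`. -/
  motion : ∀ (A : Set (ℕ → Plane)) (S : Finset ℕ) (B : ℕ → Set Trajectory),
    MeasurableSet A → (∀ j, MeasurableSet (B j)) →
    P {ω | (fun j => X j ω 0) ∈ A ∧ ∀ j ∈ S, X j ω ∈ B j} =
      ∫⁻ ω in {ω | (fun j => X j ω 0) ∈ A}, ∏ j ∈ S, K (X j ω 0) (B j) ∂P
  /-- The motion, the fading of the useful link and the fading processes of the different
  interferers are independent. -/
  indep_position : IndepFun (fun ω j => X j ω) (fun ω => (G ω, fun j => F j ω)) P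
  indep_useful : IndepFun G (fun ω j => F j ω) P
  indep_fading : iIndepFun F P
  /-- Fading is independent at times that are one time unit apart. -/
  indep_useful_step : ∀ t, IndepFun (fun ω => G ω t) (fun ω => G ω (t + 1)) P
  indep_fading_step : ∀ j t, IndepFun (fun ω => F j ω t) (fun ω => F j ω (t + 1)) P
  /-- The useful link has Rayleigh fading: its fading power is exponential with mean `1 / μ`. -/
  rayleigh : ∀ t, HasLaw (fun ω => (G ω t : ℝ)) (expMeasure μ) P
  /-- The fading of the interferers has one common law, which is arbitrary with unit mean. -/
  identDistrib_fading : ∀ i j s t, IdentDistrib (fun ω => F i ω s) (fun ω => F j ω t) P P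
  mean_fading : ∀ j t, ∫⁻ ω, (F j ω t : ℝ≥0∞) ∂P = 1

/-- The interference at the origin at time `t`. -/
def interference {Ω : Type*} (l : ℝ → ℝ≥0) (X : ℕ → Ω → Trajectory)
    (F : ℕ → Ω → ℝ≥0 → ℝ≥0) (t : ℝ≥0) (ω : Ω) : ℝ≥0∞ :=
  ∑' j, (l ‖X j ω t‖ : ℝ≥0∞) * (F j ω t : ℝ≥0∞)

/-- The SINR at the origin at time `t`, with useful link of length `R` and noise power `γ`; it is
`∞` if there is neither noise nor interference and the received signal is not zero. -/
def SINR {Ω : Type*} (l : ℝ → ℝ≥0) (R : ℝ) (γ : ℝ≥0) (X : ℕ → Ω → Trajectory)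
    (F : ℕ → Ω → ℝ≥0 → ℝ≥0) (G : Ω → ℝ≥0 → ℝ≥0) (t : ℝ≥0) (ω : Ω) : ℝ≥0∞ :=
  ((l R : ℝ≥0∞) * (G ω t : ℝ≥0∞)) / (interference l X F t ω + (γ : ℝ≥0∞))

/-- The level-crossing event at time `t`: the SINR at the origin exceeds the threshold `T`. -/
def levelCrossing {Ω : Type*} (l : ℝ → ℝ≥0) (R : ℝ) (γ T : ℝ≥0) (X : ℕ → Ω → Trajectory)
    (F : ℕ → Ω → ℝ≥0 → ℝ≥0) (G : Ω → ℝ≥0 → ℝ≥0) (t : ℝ≥0) : Set Ω :=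
  {ω | (T : ℝ≥0∞) < SINR l R γ X F G t ω}

end

/-! Rayleigh fading has an exponential tail, so given the interference I, the level crossing at time
t has conditional probability exp(-c(I(t)+γ)) with c = μT/l(R). The useful fading is independent at
t and t+1, so the joint probability is the expectation of the product of two such factors.
Everything thus reduces to the joint Laplace transform of I(t) and I(t+1),
`IsMobileNetwork.lintegral_expNeg_interference`. Motion and fading are independent marks of the
initial points; averaging them out and applying the Laplace functional
`IsPoissonPointProcess.lintegral_expNeg` gives exp(-ΛJ) with J = ∫∫ (1 - ψ(x)ψ(y)) p(x,dy) dx, where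
ψ(x) = E exp(-c l(|x|) F).

By homogeneity both one-time transforms equal exp(-Λa) with a = ∫ (1-ψ). Integrating the identity
`one_sub_add_one_sub` gives J + D = 2a with D = ∫∫ (1-ψ(x))(1-ψ(y)) p(x,dy) dx. Here a is finite
because 1-ψ(x) ≤ c l(|x|), and D > 0 because ψ < 1 wherever l > 0. Hence J < 2a, so the joint
probability exceeds the product of the marginals. -/

/-! ### Exponential and logarithm on [0, ∞] -/

/-- The function `x ↦ exp (-x)` on `[0, ∞]`, with `expNeg ∞ = 0`. -/
noncomputable def expNeg (x : ℝ≥0∞) : ℝ≥0∞ := EReal.exp (-(x : EReal))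

@[simp] lemma expNeg_zero : expNeg 0 = 1 := by simp [expNeg]

@[simp] lemma expNeg_top : expNeg ∞ = 0 := by simp [expNeg]

lemma expNeg_ofReal {x : ℝ} (hx : 0 ≤ x) :
    expNeg (ENNReal.ofReal x) = ENNReal.ofReal (Real.exp (-x)) := by
  rw [expNeg, EReal.coe_ennreal_ofReal, max_eq_left hx, ← EReal.coe_neg, EReal.exp_coe]

lemma expNeg_add (x y : ℝ≥0∞) : expNeg (x + y) = expNeg x * expNeg y := by
  rw [expNeg, EReal.coe_ennreal_add, EReal.neg_add, sub_eq_add_neg, EReal.exp_add, expNeg, expNeg]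
  · left; simp
  · right; simp

lemma continuous_expNeg : Continuous expNeg :=
  ENNReal.continuous_exp.comp (continuous_neg.comp continuous_coe_ennreal_ereal)

lemma measurable_expNeg : Measurable expNeg := continuous_expNeg.measurable

lemma strictAnti_expNeg : StrictAnti expNeg := fun x y h => by
  simpa [expNeg] using h

lemma expNeg_le_one (x : ℝ≥0∞) : expNeg x ≤ 1 := by
  simpa using strictAnti_expNeg.antitone (zero_le (a := x))

lemma expNeg_ne_top (x : ℝ≥0∞) : expNeg x ≠ ∞ :=
  ((expNeg_le_one x).trans_lt ENNReal.one_lt_top).ne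

lemma expNeg_pos {x : ℝ≥0∞} (hx : x ≠ ∞) : 0 < expNeg x := by
  simpa using strictAnti_expNeg hx.lt_top

lemma expNeg_nsmul (x : ℝ≥0∞) (n : ℕ) : expNeg (n * x) = expNeg x ^ n := by
  induction n with
  | zero => simp
  | succ n ih => rw [Nat.cast_succ, add_mul, one_mul, expNeg_add, ih, pow_succ]

lemma expNeg_finset_sum {ι : Type*} (s : Finset ι) (a : ι → ℝ≥0∞) :
    expNeg (∑ i ∈ s, a i) = ∏ i ∈ s, expNeg (a i) := by
  classical
  induction s using Finset.induction_on with
  | empty => simp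
  | insert i s hi ih => rw [Finset.sum_insert hi, Finset.prod_insert hi, expNeg_add, ih]

lemma expNeg_iSup (a : ℕ → ℝ≥0∞) : expNeg (⨆ n, a n) = ⨅ n, expNeg (a n) :=
  strictAnti_expNeg.antitone.map_ciSup_of_continuousAt continuous_expNeg.continuousAt

/-- Reduces the infinite sum over interferers to finite products, to which independence applies. -/
lemma expNeg_tsum (a : ℕ → ℝ≥0∞) :
    expNeg (∑' j, a j) = ⨅ n, ∏ j ∈ Finset.range n, expNeg (a j) := by
  rw [ENNReal.tsum_eq_iSup_nat, expNeg_iSup]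
  simp_rw [expNeg_finset_sum]

lemma one_sub_expNeg_le (x : ℝ≥0∞) : 1 - expNeg x ≤ x := by
  rcases eq_or_ne x ∞ with rfl | hx
  · simp
  · lift x to ℝ≥0 using hx
    rw [← ENNReal.ofReal_coe_nnreal, expNeg_ofReal x.coe_nonneg, ← ENNReal.ofReal_one,
      ← ENNReal.ofReal_sub _ (Real.exp_pos _).le]
    apply ENNReal.ofReal_le_ofReal
    linarith [Real.add_one_le_exp (-(x : ℝ))]

lemma one_sub_expNeg_eq_zero {x : ℝ≥0∞} : 1 - expNeg x = 0 ↔ x = 0 := by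
  rw [tsub_eq_zero_iff_le]
  constructor
  · intro h
    by_contra hx
    have := strictAnti_expNeg (pos_iff_ne_zero.2 hx)
    rw [expNeg_zero] at this
    exact absurd h (not_le.2 this)
  · rintro rfl; simp

/-- The function `s ↦ -log s` on `[0, 1]`, with values in `[0, ∞]`. -/
noncomputable def negLog (s : ℝ≥0∞) : ℝ≥0∞ := (-(ENNReal.log s)).toENNReal

lemma expNeg_negLog {s : ℝ≥0∞} (hs : s ≤ 1) : expNeg (negLog s) = s := by
  rw [expNeg, negLog, EReal.coe_toENNReal, neg_neg, ENNReal.exp_log]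
  rw [EReal.le_neg, neg_zero]
  simpa using hs

lemma measurable_negLog : Measurable negLog :=
  ENNReal.measurable_log.neg.ereal_toENNReal

/-! ### Laplace functional of a Poisson point process -/

lemma lintegral_pow_poissonMeasure (r : ℝ≥0) {s : ℝ≥0∞} (hs : s ≤ 1) :
    ∫⁻ n, s ^ n ∂(poissonMeasure r) = expNeg (r * (1 - s)) := by
  have hs' : s ≠ ∞ := (hs.trans_lt ENNReal.one_lt_top).ne
  lift s to ℝ≥0 using hs'
  have hs1 : (s : ℝ) ≤ 1 := by exact_mod_cast hs
  have hexp : HasSum (fun n : ℕ => Real.exp (-r) * r ^ n / n.factorial * (s : ℝ) ^ n)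
      (Real.exp (-(r * (1 - s)))) := by
    have h := (NormedSpace.expSeries_div_hasSum_exp ((r : ℝ) * s)).mul_left (Real.exp (-r))
    rw [← Real.exp_eq_exp_ℝ, ← Real.exp_add] at h
    convert! h using 1
    · ext n; rw [mul_pow]; ring
    · congr 1; ring
  have hrhs : (r : ℝ≥0∞) * (1 - s) = ENNReal.ofReal (r * (1 - s)) := by
    rw [ENNReal.ofReal_mul r.coe_nonneg, ENNReal.ofReal_sub _ s.coe_nonneg]
    simp
  rw [hrhs, expNeg_ofReal (mul_nonneg r.coe_nonneg (by linarith)), ← hexp.tsum_eq,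
    ENNReal.ofReal_tsum_of_nonneg (fun n => by positivity) hexp.summable, poissonMeasure,
    lintegral_sum_measure]
  refine tsum_congr fun n => ?_
  rw [lintegral_smul_measure, lintegral_dirac, smul_eq_mul, ENNReal.ofReal_mul (by positivity),
    ENNReal.ofReal_pow s.coe_nonneg, ENNReal.ofReal_coe_nnreal]

namespace IsPoissonPointProcess

variable {Ω E : Type*} [MeasurableSpace Ω] [MeasurableSpace E] {P : Measure Ω}
  {N : Ω → Measure E} {ν : Measure E}

lemma lintegral_expNeg_mul_count (h : IsPoissonPointProcess P N ν) {B : Set E}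
    (hB : MeasurableSet B) (hν : ν B ≠ ∞) (a : ℝ≥0∞) :
    ∫⁻ ω, expNeg (a * N ω B) ∂P = expNeg (ν B * (1 - expNeg a)) := by
  have hm : Measurable fun x : ℝ≥0∞ => expNeg (a * x) := measurable_expNeg.comp (by fun_prop)
  rw [(h.law_count B hB hν).lintegral_comp (f := fun x => expNeg (a * x)) hm.aemeasurable,
    lintegral_map hm (by fun_prop)]
  simp_rw [mul_comm a, expNeg_nsmul]
  rw [lintegral_pow_poissonMeasure _ (expNeg_le_one a), ENNReal.coe_toNNReal hν]

/-- The Laplace functional of a Poisson point process at a simple function. -/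
lemma lintegral_expNeg_simpleFunc [IsProbabilityMeasure P] (h : IsPoissonPointProcess P N ν)
    (hN : ∀ B, MeasurableSet B → Measurable fun ω => N ω B) (f : SimpleFunc E ℝ≥0∞)
    (hf : f.FinMeasSupp ν) :
    ∫⁻ ω, expNeg (∫⁻ x, f x ∂(N ω)) ∂P = expNeg (∫⁻ x, (1 - expNeg (f x)) ∂ν) := by
  have hind : iIndepFun (fun (y : f.range) ω => N ω (f ⁻¹' {y.1})) P := by
    let e := f.range.equivFin
    have h1 := h.indep_count _ (fun i => f ⁻¹' {(e.symm i).1})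
      (fun i => f.measurableSet_fiber _) (fun i j hij => Set.disjoint_left.2 fun x hi hj => hij
        (e.symm.injective (Subtype.ext (Eq.trans (Eq.symm hi) hj))))
    have h2 := h1.precomp e.injective
    simpa using h2
  have hm : ∀ y : f.range, Measurable fun x : ℝ≥0∞ => expNeg (y.1 * x) :=
    fun y => measurable_expNeg.comp (by fun_prop)
  have hind' := hind.comp (fun (y : f.range) x => expNeg (y.1 * x)) hm
  have hprod := lintegral_prod_eq_prod_lintegral_of_indepFun Finset.univ _ hind'
    (fun y => (hm y).comp (hN _ (f.measurableSet_fiber _)))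
  have hfac : ∀ y : f.range, ∫⁻ ω, expNeg (y.1 * N ω (f ⁻¹' {y.1})) ∂P
      = expNeg ((1 - expNeg y.1) * ν (f ⁻¹' {y.1})) := by
    intro y
    -- The level set of the value 0 may have infinite intensity, where no Poisson law is available;
    -- its factor is 1 on both sides.
    by_cases hy : y.1 = 0
    · simp [hy]
    · rw [h.lintegral_expNeg_mul_count (f.measurableSet_fiber _)
        (hf.meas_preimage_singleton_ne_zero hy).ne, mul_comm]
  have hrhs : ∫⁻ x, (1 - expNeg (f x)) ∂ν
      = ∑ y : f.range, (1 - expNeg y.1) * ν (f ⁻¹' {y.1}) := by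
    have := SimpleFunc.lintegral_eq_lintegral (f.map fun y => 1 - expNeg y) ν
    rw [SimpleFunc.map_lintegral] at this
    rw [Finset.sum_coe_sort f.range (fun y => (1 - expNeg y) * ν (f ⁻¹' {y})), ← this]
    rfl
  rw [hrhs, expNeg_finset_sum, ← Finset.prod_congr rfl fun y _ => hfac y]
  refine Eq.trans (lintegral_congr fun ω => ?_) hprod
  rw [SimpleFunc.lintegral_eq_lintegral, SimpleFunc.lintegral,
    ← Finset.sum_coe_sort f.range (fun y => y * N ω (f ⁻¹' {y})), expNeg_finset_sum]
  rfl

/-- The Laplace functional of a Poisson point process. -/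
theorem lintegral_expNeg [IsProbabilityMeasure P] [SigmaFinite ν]
    (h : IsPoissonPointProcess P N ν)
    (hN : ∀ B, MeasurableSet B → Measurable fun ω => N ω B) {f : E → ℝ≥0∞} (hf : Measurable f) :
    ∫⁻ ω, expNeg (∫⁻ x, f x ∂(N ω)) ∂P = expNeg (∫⁻ x, (1 - expNeg (f x)) ∂ν) := by
  let S := spanningSets ν
  have hS : ∀ n, MeasurableSet (S n) := measurableSet_spanningSets ν
  -- Cutting off to the spanning sets makes each approximation finitely supported while keeping it
  -- increasing to `f`.
  let g : ℕ → SimpleFunc E ℝ≥0∞ := fun n => (SimpleFunc.eapprox f n).restrict (S n)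
  have hg : ∀ n x, g n x = (S n).indicator (SimpleFunc.eapprox f n) x :=
    fun n x => SimpleFunc.restrict_apply _ (hS n) x
  have hmono : Monotone fun n x => g n x := by
    intro m n hmn x
    simp only [hg]
    refine (Set.indicator_le_indicator (SimpleFunc.monotone_eapprox f hmn x)).trans ?_
    exact Set.indicator_le_indicator_of_subset (monotone_spanningSets ν hmn)
      (fun _ => zero_le) x
  have hsup : ∀ x, ⨆ n, g n x = f x := by
    intro x
    apply le_antisymm
    · refine iSup_le fun n => ?_
      rw [hg, ← SimpleFunc.iSup_eapprox_apply hf x]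
      exact (Set.indicator_le_self' (fun _ _ => zero_le) x).trans
        (le_iSup (fun n => SimpleFunc.eapprox f n x) n)
    · rw [← SimpleFunc.iSup_eapprox_apply hf x]
      refine iSup_le fun n => ?_
      obtain ⟨m, hm⟩ : ∃ m, x ∈ S m := 
        Set.mem_iUnion.1 ((iUnion_spanningSets ν).symm ▸ Set.mem_univ x : x ∈ ⋃ n, spanningSets ν n)
      refine le_iSup_of_le (max n m) ?_
      rw [hg, Set.indicator_of_mem (monotone_spanningSets ν (le_max_right n m) hm)]
      exact SimpleFunc.monotone_eapprox f (le_max_left n m) x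
  have hfin : ∀ n, (g n).FinMeasSupp ν := by
    intro n
    rw [SimpleFunc.finMeasSupp_iff_support]
    refine (measure_mono fun x hx => ?_).trans_lt (measure_spanningSets_lt_top ν n)
    by_contra hxn
    exact hx (by rw [hg, Set.indicator_of_notMem hxn])
  have hL : ∀ ω, ∫⁻ x, f x ∂(N ω) = ⨆ n, ∫⁻ x, g n x ∂(N ω) := by
    intro ω
    rw [← lintegral_iSup (fun n => (g n).measurable) hmono]
    simp_rw [hsup]
  have hmeas : ∀ n, Measurable fun ω => expNeg (∫⁻ x, g n x ∂(N ω)) := by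
    intro n
    refine measurable_expNeg.comp ?_
    simp_rw [SimpleFunc.lintegral_eq_lintegral, SimpleFunc.lintegral]
    exact Finset.measurable_fun_sum _ fun y _ =>
      (hN _ ((g n).measurableSet_fiber y)).const_mul y
  have hR : ∫⁻ x, (1 - expNeg (f x)) ∂ν = ⨆ n, ∫⁻ x, (1 - expNeg (g n x)) ∂ν := by
    rw [← lintegral_iSup (f := fun n x => 1 - expNeg (g n x))
      (fun n => measurable_const.sub (measurable_expNeg.comp (g n).measurable))]
    · simp_rw [← ENNReal.sub_iInf, ← expNeg_iSup, hsup]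
    · intro m n hmn x
      exact tsub_le_tsub_left (strictAnti_expNeg.antitone (hmono hmn x)) 1
  simp_rw [hL, hR, expNeg_iSup]
  rw [lintegral_iInf hmeas]
  · exact iInf_congr fun n => h.lintegral_expNeg_simpleFunc hN (g n) (hfin n)
  · intro m n hmn ω
    exact strictAnti_expNeg.antitone (lintegral_mono (hmono hmn))
  · exact ((lintegral_mono fun ω => expNeg_le_one _).trans_lt (by simp)).ne

end IsPoissonPointProcess

/-! ### Integration under independence and independent motion -/

lemma ProbabilityTheory.IndepFun.lintegral_comp_pair {Ω α β : Type*} [MeasurableSpace Ω]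
    [MeasurableSpace α] [MeasurableSpace β] {P : Measure Ω} [IsProbabilityMeasure P]
    {U : Ω → α} {V : Ω → β} (h : IndepFun U V P) (hU : Measurable U) (hV : Measurable V)
    {H : α × β → ℝ≥0∞} (hH : Measurable H) :
    ∫⁻ ω, H (U ω, V ω) ∂P = ∫⁻ ω, ∫⁻ ω', H (U ω, V ω') ∂P ∂P := by
  have h1 := (indepFun_iff_map_prod_eq_prod_map_map hU.aemeasurable hV.aemeasurable).1 h
  have := Measure.isProbabilityMeasure_map (μ := P) hU.aemeasurable
  have := Measure.isProbabilityMeasure_map (μ := P) hV.aemeasurable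
  rw [← lintegral_map hH (hU.prodMk hV), h1, lintegral_prod _ hH.aemeasurable,
    lintegral_map (by fun_prop) hU]
  exact lintegral_congr fun ω => lintegral_map (by fun_prop) hV

section Motion

variable {Ω E W : Type*} [MeasurableSpace Ω] [MeasurableSpace E] [MeasurableSpace W]
  {P : Measure Ω} {K : Kernel E W}

/-- An identity between expectations that holds for indicators of sets holds for all functions. -/
lemma lintegral_comp_mul_eq_of_forall_set {Y : Ω → W} (hY : Measurable Y) {x : Ω → E}
    (hx : Measurable x) {V V' : Ω → ℝ≥0∞} (hV : Measurable V) (hV' : Measurable V')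
    (hset : ∀ A, MeasurableSet A →
      ∫⁻ ω, V ω * (Y ⁻¹' A).indicator 1 ω ∂P = ∫⁻ ω, V' ω * K (x ω) A ∂P)
    {h : W → ℝ≥0∞} (hh : Measurable h) :
    ∫⁻ ω, V ω * h (Y ω) ∂P = ∫⁻ ω, V' ω * ∫⁻ w, h w ∂(K (x ω)) ∂P := by
  have hKx : Measurable fun ω => K (x ω) := K.measurable.comp hx
  -- The hypothesis on sets says that two measures on `W` coincide; the claim is the equality of the
  -- integrals of `h` against them.
  have key : (P.withDensity V).map Y = (P.withDensity V').bind fun ω => K (x ω) := by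
    ext A hA
    rw [Measure.map_apply hY hA, Measure.bind_apply hA hKx.aemeasurable,
      lintegral_withDensity_eq_lintegral_mul P hV' (g := fun ω => K (x ω) A)
        ((K.measurable_coe hA).comp hx), ← lintegral_indicator_one (hY hA),
      lintegral_withDensity_eq_lintegral_mul P hV (measurable_one.indicator (hY hA))]
    exact hset A hA
  have h1 : ∫⁻ w, h w ∂((P.withDensity V).map Y) =
      ∫⁻ w, h w ∂((P.withDensity V').bind fun ω => K (x ω)) := by rw [key]
  rw [lintegral_map hh hY, Measure.lintegral_bind hKx.aemeasurable hh.aemeasurable,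
    lintegral_withDensity_eq_lintegral_mul P hV (g := fun ω => h (Y ω)) (hh.comp hY),
    lintegral_withDensity_eq_lintegral_mul P hV' (g := fun ω => ∫⁻ w, h w ∂(K (x ω)))
      (hh.lintegral_kernel.comp hx)] at h1
  exact h1

/-- Points that move independently according to `K`, given their initial positions. -/
lemma lintegral_prod_comp_eq_lintegral_prod_kernel {Y : ℕ → Ω → W} (hY : ∀ j, Measurable (Y j))
    {x : ℕ → Ω → E} (hx : ∀ j, Measurable (x j))
    (hset : ∀ (S : Finset ℕ) (B : ℕ → Set W), (∀ j, MeasurableSet (B j)) →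
      P {ω | ∀ j ∈ S, Y j ω ∈ B j} = ∫⁻ ω, ∏ j ∈ S, K (x j ω) (B j) ∂P)
    {h : W → ℝ≥0∞} (hh : Measurable h) (U : Finset ℕ) :
    ∫⁻ ω, ∏ j ∈ U, h (Y j ω) ∂P = ∫⁻ ω, ∏ j ∈ U, ∫⁻ w, h w ∂(K (x j ω)) ∂P := by
  -- The induction needs mixed products: sets are still tested at the indices in `S`, and functions
  -- already at those in `U`.
  suffices H : ∀ (S : Finset ℕ) (B : ℕ → Set W), (∀ j, MeasurableSet (B j)) → Disjoint U S →
      ∫⁻ ω, (∏ j ∈ S, (Y j ⁻¹' B j).indicator 1 ω) * ∏ j ∈ U, h (Y j ω) ∂P =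
      ∫⁻ ω, (∏ j ∈ S, K (x j ω) (B j)) * ∏ j ∈ U, ∫⁻ w, h w ∂(K (x j ω)) ∂P by
    simpa using H ∅ (fun _ => Set.univ) (fun _ => MeasurableSet.univ) (Finset.disjoint_empty_right U)
  have hK : ∀ j A, MeasurableSet A → Measurable fun ω => K (x j ω) A :=
    fun j A hA => (K.measurable_coe hA).comp (hx j)
  have hI : ∀ j A, MeasurableSet A → Measurable ((Y j ⁻¹' A).indicator (1 : Ω → ℝ≥0∞)) :=
    fun j A hA => measurable_one.indicator (hY j hA)
  induction U using Finset.induction_on with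
  | empty =>
    intro S B hB _
    simp only [Finset.prod_empty, mul_one]
    rw [← hset S B hB, ← lintegral_indicator_one]
    · refine lintegral_congr fun ω => ?_
      by_cases hω : ∀ j ∈ S, Y j ω ∈ B j
      · rw [Set.indicator_of_mem (by exact hω)]
        exact Finset.prod_eq_one fun j hj => Set.indicator_of_mem (by exact hω j hj) _
      · rw [Set.indicator_of_notMem (by exact hω)]
        push Not at hω
        obtain ⟨j, hj, hjB⟩ := hω
        exact Finset.prod_eq_zero hj (Set.indicator_of_notMem (by exact hjB) _)
    · have : {ω | ∀ j ∈ S, Y j ω ∈ B j} = ⋂ j ∈ S, Y j ⁻¹' B j := by ext; simp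
      rw [this]
      exact Finset.measurableSet_biInter S fun j _ => hY j (hB j)
  | insert i U hi ih =>
    intro S B hB hd
    rw [Finset.disjoint_insert_left] at hd
    simp only [Finset.prod_insert hi]
    have := lintegral_comp_mul_eq_of_forall_set (P := P) (K := K) (hY i) (hx i)
      (V := fun ω => (∏ j ∈ S, (Y j ⁻¹' B j).indicator 1 ω) * ∏ j ∈ U, h (Y j ω))
      (V' := fun ω => (∏ j ∈ S, K (x j ω) (B j)) * ∏ j ∈ U, ∫⁻ w, h w ∂(K (x j ω)))
      ((Finset.measurable_fun_prod _ fun j _ => hI j _ (hB j)).mul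
        (Finset.measurable_fun_prod _ fun j _ => hh.comp (hY j)))
      ((Finset.measurable_fun_prod _ fun j _ => hK j _ (hB j)).mul
        (Finset.measurable_fun_prod _ fun j _ => hh.lintegral_kernel.comp (hx j))) ?_ hh
    · refine (lintegral_congr fun ω => ?_).trans (this.trans (lintegral_congr fun ω => ?_)) <;> ring
    · intro A hA
      have hne : ∀ j ∈ S, j ≠ i := fun j hj hji => hd.1 (hji ▸ hj)
      -- To replace a set by `h` at index `i`, it suffices to test all sets `A` there: this is the
      -- induction hypothesis with `i` on the side of `S`.
      have h1 := ih (insert i S) (Function.update B i A)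
        (fun j => by
          by_cases hj : j = i
          · subst hj; simpa using hA
          · simpa [hj] using hB j)
        (Finset.disjoint_insert_right.2 ⟨hi, hd.2⟩)
      have e1 : ∀ ω, ∏ j ∈ S, (Y j ⁻¹' Function.update B i A j).indicator (1 : Ω → ℝ≥0∞) ω =
          ∏ j ∈ S, (Y j ⁻¹' B j).indicator (1 : Ω → ℝ≥0∞) ω := fun ω =>
        Finset.prod_congr rfl fun j hj => by rw [Function.update_of_ne (hne j hj)]
      have e2 : ∀ ω, ∏ j ∈ S, K (x j ω) (Function.update B i A j) = ∏ j ∈ S, K (x j ω) (B j) :=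
        fun ω => Finset.prod_congr rfl fun j hj => by rw [Function.update_of_ne (hne j hj)]
      simp only [Finset.prod_insert hd.1, Function.update_self, e1, e2] at h1
      refine (lintegral_congr fun ω => ?_).trans (h1.trans (lintegral_congr fun ω => ?_)) <;> ring

end Motion

/-! ### Laplace transform of the fading -/

/-- The interference at time `t` as a function of the trajectories and the fading. -/
noncomputable def totalInterference (l : ℝ → ℝ≥0) (x : ℕ → Trajectory) (f : ℕ → ℝ≥0 → ℝ≥0)
    (t : ℝ≥0) : ℝ≥0∞ :=
  ∑' j, (l ‖x j t‖ : ℝ≥0∞) * (f j t : ℝ≥0∞)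

lemma measurable_totalInterference {l : ℝ → ℝ≥0} (hl : Measurable l) (t : ℝ≥0) :
    Measurable fun q : (ℕ → Trajectory) × (ℕ → ℝ≥0 → ℝ≥0) => totalInterference l q.1 q.2 t := by
  refine Measurable.tsum fun j => ?_
  have h1 : Measurable fun q : (ℕ → Trajectory) × (ℕ → ℝ≥0 → ℝ≥0) => q.1 j t := by fun_prop
  have h2 : Measurable fun q : (ℕ → Trajectory) × (ℕ → ℝ≥0 → ℝ≥0) => q.2 j t := by fun_prop
  exact (hl.comp h1.norm).coe_nnreal_ennreal.mul h2.coe_nnreal_ennreal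

/-- The Laplace transform of a measure on `[0, ∞)`. -/
noncomputable def laplace (ρ : Measure ℝ≥0) (s : ℝ≥0∞) : ℝ≥0∞ := ∫⁻ u, expNeg (s * u) ∂ρ

section Laplace

variable {ρ : Measure ℝ≥0} [IsProbabilityMeasure ρ]

lemma measurable_laplace : Measurable (laplace ρ) := by
  have : Measurable fun q : ℝ≥0∞ × ℝ≥0 => expNeg (q.1 * q.2) :=
    measurable_expNeg.comp (measurable_fst.mul measurable_snd.coe_nnreal_ennreal)
  exact this.lintegral_prod_right'

lemma measurable_expNeg_mul (s : ℝ≥0∞) : Measurable fun u : ℝ≥0 => expNeg (s * u) :=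
  measurable_expNeg.comp (measurable_coe_nnreal_ennreal.const_mul s)

lemma laplace_le_one (s : ℝ≥0∞) : laplace ρ s ≤ 1 :=
  (lintegral_mono fun _ => expNeg_le_one _).trans (by simp)

@[simp] lemma laplace_zero : laplace ρ 0 = 1 := by simp [laplace]

lemma one_sub_laplace (s : ℝ≥0∞) :
    1 - laplace ρ s = ∫⁻ u, (1 - expNeg (s * u)) ∂ρ := by
  rw [lintegral_sub (measurable_expNeg_mul s)
    ((laplace_le_one s).trans_lt ENNReal.one_lt_top).ne
    (Eventually.of_forall fun u => expNeg_le_one _)]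
  simp [laplace]

/-- Follows from 1 - exp(-x) ≤ x and the unit mean; it transfers the integrability of the path loss
to 1 - ψ. -/
lemma one_sub_laplace_le (hρ : ∫⁻ u, (u : ℝ≥0∞) ∂ρ = 1) (s : ℝ≥0∞) : 1 - laplace ρ s ≤ s := by
  rw [one_sub_laplace]
  calc ∫⁻ u, (1 - expNeg (s * u)) ∂ρ ≤ ∫⁻ u : ℝ≥0, s * u ∂ρ :=
        lintegral_mono fun u => one_sub_expNeg_le _
    _ = s := by rw [lintegral_const_mul _ measurable_coe_nnreal_ennreal, hρ, mul_one]

/-- Fading of mean 1 is not almost surely 0. This is the source of the strict inequality. -/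
lemma one_sub_laplace_pos (hρ : ∫⁻ u, (u : ℝ≥0∞) ∂ρ = 1) {s : ℝ≥0∞} (hs : s ≠ 0) :
    1 - laplace ρ s ≠ 0 := by
  intro h
  rw [one_sub_laplace, lintegral_eq_zero_iff (f := fun u : ℝ≥0 => 1 - expNeg (s * u))
    (measurable_const.sub (measurable_expNeg_mul s))] at h
  have h0 : (fun u : ℝ≥0 => (u : ℝ≥0∞)) =ᵐ[ρ] 0 := by
    filter_upwards [h] with u hu
    simpa [hs] using one_sub_expNeg_eq_zero.1 hu
  rw [lintegral_congr_ae h0] at hρ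
  simp at hρ

end Laplace

/-! ### Joint Laplace transform of the interference -/

section Network

variable {Ω : Type*} [MeasurableSpace Ω] {P : Measure Ω} {Λ : ℝ≥0}
  {K : Kernel Plane Trajectory} {μ : ℝ} {X : ℕ → Ω → Trajectory} {F : ℕ → Ω → ℝ≥0 → ℝ≥0}
  {G : Ω → ℝ≥0 → ℝ≥0}

/-- The common law of the fading of the interferers. -/
noncomputable def fadingLaw (P : Measure Ω) (F : ℕ → Ω → ℝ≥0 → ℝ≥0) : Measure ℝ≥0 :=
  P.map fun ω => F 0 ω 0

namespace IsMobileNetwork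

lemma measurable_fading_apply (h : IsMobileNetwork P Λ K μ X F G) (j : ℕ) (t : ℝ≥0) :
    Measurable fun ω => F j ω t := (measurable_pi_apply t).comp (h.measurable_fading j)

lemma isProbabilityMeasure_fadingLaw [IsProbabilityMeasure P]
    (h : IsMobileNetwork P Λ K μ X F G) :
    IsProbabilityMeasure (fadingLaw P F) :=
  Measure.isProbabilityMeasure_map (h.measurable_fading_apply 0 0).aemeasurable

lemma mean_fadingLaw (h : IsMobileNetwork P Λ K μ X F G) :
    ∫⁻ u, (u : ℝ≥0∞) ∂(fadingLaw P F) = 1 := by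
  rw [fadingLaw, lintegral_map measurable_coe_nnreal_ennreal (h.measurable_fading_apply 0 0)]
  exact h.mean_fading 0 0

lemma lintegral_expNeg_fading (h : IsMobileNetwork P Λ K μ X F G) (j : ℕ) (t : ℝ≥0) (s : ℝ≥0∞) :
    ∫⁻ ω, expNeg (s * F j ω t) ∂P = laplace (fadingLaw P F) s := by
  have hid := (h.identDistrib_fading j 0 t 0).map_eq
  rw [laplace, fadingLaw, ← hid,
    lintegral_map (measurable_expNeg_mul s) (h.measurable_fading_apply j t)]

/-- Independence is used twice: between interferers, then between the two times for each interferer.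
-/
lemma lintegral_prod_expNeg_fading (h : IsMobileNetwork P Λ K μ X F G) (t : ℝ≥0)
    (a b : ℕ → ℝ≥0∞) (n : ℕ) :
    ∫⁻ ω, ∏ j ∈ Finset.range n, expNeg (a j * F j ω t + b j * F j ω (t + 1)) ∂P =
      ∏ j ∈ Finset.range n, laplace (fadingLaw P F) (a j) * laplace (fadingLaw P F) (b j) := by
  have hm : ∀ j, Measurable fun f : ℝ≥0 → ℝ≥0 => expNeg (a j * f t + b j * f (t + 1)) :=
    fun j => measurable_expNeg.comp
      (((measurable_pi_apply t).coe_nnreal_ennreal.const_mul _).add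
        ((measurable_pi_apply (t + 1)).coe_nnreal_ennreal.const_mul _))
  have h1 := lintegral_prod_eq_prod_lintegral_of_indepFun (Finset.range n) _
    (h.indep_fading.comp _ hm) fun j => (hm j).comp (h.measurable_fading j)
  refine h1.trans (Finset.prod_congr rfl fun j _ => ?_)
  rw [← h.lintegral_expNeg_fading j t, ← h.lintegral_expNeg_fading j (t + 1)]
  have h2 := lintegral_mul_eq_lintegral_mul_lintegral_of_indepFun
    ((measurable_expNeg_mul (a j)).comp (h.measurable_fading_apply j t))
    ((measurable_expNeg_mul (b j)).comp (h.measurable_fading_apply j (t + 1)))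
    ((h.indep_fading_step j t).comp (measurable_expNeg_mul (a j)) (measurable_expNeg_mul (b j)))
  refine Eq.trans (lintegral_congr fun ω => ?_) h2
  exact expNeg_add _ _

lemma indepFun_position_fading (h : IsMobileNetwork P Λ K μ X F G) :
    IndepFun (fun ω j => X j ω) (fun ω j => F j ω) P :=
  h.indep_position.comp measurable_id measurable_snd

lemma measurable_positions (h : IsMobileNetwork P Λ K μ X F G) : Measurable fun ω j => X j ω :=
  measurable_pi_lambda _ h.measurable_position

lemma measurable_fadings (h : IsMobileNetwork P Λ K μ X F G) : Measurable fun ω j => F j ω :=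
  measurable_pi_lambda _ h.measurable_fading

/-- The fading of the useful link is independent of the motion and the fading of the interferers. -/
lemma lintegral_comp_useful [IsProbabilityMeasure P]
    (h : IsMobileNetwork P Λ K μ X F G)
    {H : (ℝ≥0 → ℝ≥0) × ((ℕ → Trajectory) × (ℕ → ℝ≥0 → ℝ≥0)) → ℝ≥0∞} (hH : Measurable H) :
    ∫⁻ ω, H (G ω, (fun j => X j ω, fun j => F j ω)) ∂P =
      ∫⁻ ω, ∫⁻ ω', H (G ω', (fun j => X j ω, fun j => F j ω)) ∂P ∂P := by
  have hG := h.measurable_useful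
  have hX := h.measurable_positions
  have hF := h.measurable_fadings
  have hm : Measurable fun q : (ℕ → Trajectory) × (ℕ → ℝ≥0 → ℝ≥0) =>
      ∫⁻ ω, H (G ω, q) ∂P :=
    (hH.comp ((hG.comp measurable_snd).prodMk measurable_fst)).lintegral_prod_right'
      (f := fun r : ((ℕ → Trajectory) × (ℕ → ℝ≥0 → ℝ≥0)) × Ω => H (G r.2, r.1))
  -- Both sides are brought to the same triple integral: here motion is split from interferer fading
  -- on the right; then, on the left, motion is split from all fading and useful from interferer
  -- fading.
  rw [h.indepFun_position_fading.lintegral_comp_pair hX hF hm]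
  have hH1 : Measurable fun r : (ℕ → Trajectory) × ((ℝ≥0 → ℝ≥0) × (ℕ → ℝ≥0 → ℝ≥0)) =>
      H (r.2.1, (r.1, r.2.2)) := hH.comp (by fun_prop)
  refine (h.indep_position.lintegral_comp_pair hX (hG.prodMk hF) hH1).trans ?_
  refine lintegral_congr fun ω => ?_
  have hH2 : Measurable fun r : (ℕ → ℝ≥0 → ℝ≥0) × (ℝ≥0 → ℝ≥0) =>
      H (r.2, (fun j => X j ω, r.1)) := hH.comp (by fun_prop)
  exact h.indep_useful.symm.lintegral_comp_pair hF hG hH2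

/-- The conditional expectation of a finite product given the trajectories. -/
lemma lintegral_prod_expNeg_position_fading [IsProbabilityMeasure P]
    (h : IsMobileNetwork P Λ K μ X F G) {l : ℝ → ℝ≥0} (hl : Measurable l) (t : ℝ≥0)
    (c₁ c₂ : ℝ≥0∞) (n : ℕ) :
    ∫⁻ ω, ∏ j ∈ Finset.range n, expNeg (c₁ * l ‖X j ω t‖ * F j ω t +
      c₂ * l ‖X j ω (t + 1)‖ * F j ω (t + 1)) ∂P =
    ∫⁻ ω, ∏ j ∈ Finset.range n, laplace (fadingLaw P F) (c₁ * l ‖X j ω t‖) *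
      laplace (fadingLaw P F) (c₂ * l ‖X j ω (t + 1)‖) ∂P := by
  let H : (ℕ → Trajectory) × (ℕ → ℝ≥0 → ℝ≥0) → ℝ≥0∞ := fun q =>
    ∏ j ∈ Finset.range n, expNeg (c₁ * l ‖q.1 j t‖ * q.2 j t +
      c₂ * l ‖q.1 j (t + 1)‖ * q.2 j (t + 1))
  have hterm : ∀ (c : ℝ≥0∞) (j : ℕ) (s : ℝ≥0),
      Measurable fun q : (ℕ → Trajectory) × (ℕ → ℝ≥0 → ℝ≥0) => c * l ‖q.1 j s‖ * q.2 j s := by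
    intro c j s
    have h1 : Measurable fun q : (ℕ → Trajectory) × (ℕ → ℝ≥0 → ℝ≥0) => q.1 j s := by fun_prop
    have h2 : Measurable fun q : (ℕ → Trajectory) × (ℕ → ℝ≥0 → ℝ≥0) => q.2 j s := by fun_prop
    exact ((hl.comp h1.norm).coe_nnreal_ennreal.const_mul c).mul h2.coe_nnreal_ennreal
  have hm : Measurable H := Finset.measurable_fun_prod _ fun j _ =>
    measurable_expNeg.comp ((hterm c₁ j t).add (hterm c₂ j (t + 1)))
  refine (h.indepFun_position_fading.lintegral_comp_pair h.measurable_positions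
    h.measurable_fadings (H := H) hm).trans (lintegral_congr fun ω => ?_)
  exact h.lintegral_prod_expNeg_fading t (fun j => c₁ * l ‖X j ω t‖)
    (fun j => c₂ * l ‖X j ω (t + 1)‖) n

/-- The conditional expectation of a finite product given the initial positions. -/
lemma lintegral_prod_trajectory (h : IsMobileNetwork P Λ K μ X F G) {φ : Trajectory → ℝ≥0∞}
    (hφ : Measurable φ) (n : ℕ) :
    ∫⁻ ω, ∏ j ∈ Finset.range n, φ (X j ω) ∂P =
      ∫⁻ ω, ∏ j ∈ Finset.range n, ∫⁻ w, φ w ∂(K (X j ω 0)) ∂P := by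
  refine lintegral_prod_comp_eq_lintegral_prod_kernel (x := fun j ω => X j ω 0)
    h.measurable_position
    (fun j => (measurable_pi_apply 0).comp (h.measurable_position j)) (fun S B hB => ?_) hφ _
  simpa using h.motion Set.univ S B MeasurableSet.univ hB

/-- The expectation of a product over the initial positions. -/
lemma lintegral_prod_initial [IsProbabilityMeasure P] (h : IsMobileNetwork P Λ K μ X F G)
    {g : Plane → ℝ≥0∞} (hg : Measurable g) (hg1 : ∀ x, g x ≤ 1) :
    ∫⁻ ω, ⨅ n, ∏ j ∈ Finset.range n, g (X j ω 0) ∂P = expNeg (Λ * ∫⁻ x, (1 - g x)) := by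
  have hX0 : ∀ j, Measurable fun ω => X j ω 0 :=
    fun j => (measurable_pi_apply 0).comp (h.measurable_position j)
  have hN : ∀ B, MeasurableSet B → Measurable fun ω => interfererProcess X 0 ω B := by
    intro B hB
    simp only [interfererProcess, Measure.sum_apply _ hB, Measure.dirac_apply' _ hB]
    exact Measurable.tsum fun j => (measurable_one.indicator hB).comp (hX0 j)
  -- The Laplace functional is applied to -log g, which is ∞ where g vanishes.
  have hgm : Measurable fun x => negLog (g x) := measurable_negLog.comp hg
  have h1 := h.poisson.lintegral_expNeg hN hgm
  simp_rw [fun x => expNeg_negLog (hg1 x)] at h1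
  have h2 : ∫⁻ x, (1 - g x) ∂(Λ • (volume : Measure Plane)) = Λ * ∫⁻ x, (1 - g x) := by
    rw [lintegral_smul_measure]
    rfl
  rw [← h2, ← h1]
  refine lintegral_congr fun ω => ?_
  rw [interfererProcess, lintegral_sum_measure]
  simp_rw [lintegral_dirac' _ hgm]
  rw [expNeg_tsum]
  simp_rw [fun x => expNeg_negLog (hg1 x)]

/-- Factors at most 1 make the partial products decrease, so monotone convergence applies. -/
lemma lintegral_iInf_prod [IsProbabilityMeasure P] {a : ℕ → Ω → ℝ≥0∞}
    (ham : ∀ j, Measurable (a j)) (ha : ∀ j ω, a j ω ≤ 1) :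
    ∫⁻ ω, ⨅ n, ∏ j ∈ Finset.range n, a j ω ∂P =
      ⨅ n, ∫⁻ ω, ∏ j ∈ Finset.range n, a j ω ∂P := by
  refine lintegral_iInf (fun n => Finset.measurable_fun_prod _ fun j _ => ham j) ?_ (by simp)
  refine antitone_nat_of_succ_le fun n ω => ?_
  simp only [Finset.prod_range_succ]
  exact mul_le_of_le_one_right' (ha n ω)

/-- The joint Laplace transform of the interference at two times that are one unit apart. -/
theorem lintegral_expNeg_interference [IsProbabilityMeasure P] [IsMarkovKernel K]
    (h : IsMobileNetwork P Λ K μ X F G)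
    {l : ℝ → ℝ≥0} (hl : Measurable l) {t : ℝ≥0} {p : Kernel Plane Plane}
    (hp : RepresentsMotion K t p) (c₁ c₂ : ℝ≥0∞) :
    ∫⁻ ω, expNeg (c₁ * interference l X F t ω + c₂ * interference l X F (t + 1) ω) ∂P =
      expNeg (Λ * ∫⁻ z : Plane × Plane, (1 - laplace (fadingLaw P F) (c₁ * l ‖z.1‖) *
        laplace (fadingLaw P F) (c₂ * l ‖z.2‖)) ∂(volume.compProd p)) := by
  have := h.isProbabilityMeasure_fadingLaw
  set ρ := fadingLaw P F
  let φ : Plane × Plane → ℝ≥0∞ := fun z => laplace ρ (c₁ * l ‖z.1‖) * laplace ρ (c₂ * l ‖z.2‖)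
  have hφ : Measurable φ :=
    (measurable_laplace.comp ((hl.comp measurable_fst.norm).coe_nnreal_ennreal.const_mul _)).mul
      (measurable_laplace.comp ((hl.comp measurable_snd.norm).coe_nnreal_ennreal.const_mul _))
  have hφ1 : ∀ z, φ z ≤ 1 := fun z => mul_le_one' (laplace_le_one _) (laplace_le_one _)
  have hev : Measurable fun w : Trajectory => (w t, w (t + 1)) := by fun_prop
  let φ' : Trajectory → ℝ≥0∞ := fun w => φ (w t, w (t + 1))
  have hφ' : Measurable φ' := hφ.comp hev
  -- The mean factor contributed by an interferer starting at `x`. Working from the initial points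
  -- avoids proving that the process is Poisson at time `t`.
  let g : Plane → ℝ≥0∞ := fun x => ∫⁻ w, φ' w ∂(K x)
  have hg : Measurable g := hφ'.lintegral_kernel
  have hg1 : ∀ x, g x ≤ 1 := fun x => (lintegral_mono fun w => hφ1 _).trans (by simp)
  have hX0 : ∀ j, Measurable fun ω => X j ω 0 :=
    fun j => (measurable_pi_apply 0).comp (h.measurable_position j)
  have step4 : ∫⁻ x, (1 - g x) ∂(volume : Measure Plane) =
      ∫⁻ z, (1 - φ z) ∂(volume.compProd p) := by
    have h1 : ∀ x, 1 - g x = ∫⁻ w, (1 - φ' w) ∂(K x) := by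
      intro x
      rw [lintegral_sub hφ' ((hg1 x).trans_lt ENNReal.one_lt_top).ne
        (Eventually.of_forall fun w => hφ1 _)]
      simp [g]
    have hm : Measurable fun z => 1 - φ z := measurable_const.sub hφ
    simp_rw [h1]
    rw [← show _ = _ from hp, lintegral_map hm hev,
      Measure.lintegral_bind (f := fun w : Trajectory => 1 - φ (w t, w (t + 1)))
        K.aemeasurable (hm.comp hev).aemeasurable]
  have hXF : ∀ j, Measurable fun ω => expNeg (c₁ * l ‖X j ω t‖ * F j ω t +
      c₂ * l ‖X j ω (t + 1)‖ * F j ω (t + 1)) := by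
    intro j
    have h1 : ∀ s, Measurable fun ω => X j ω s :=
      fun s => (measurable_pi_apply s).comp (h.measurable_position j)
    exact measurable_expNeg.comp ((((hl.comp (h1 t).norm).coe_nnreal_ennreal.const_mul _).mul
        (h.measurable_fading_apply j t).coe_nnreal_ennreal).add
        (((hl.comp (h1 (t + 1)).norm).coe_nnreal_ennreal.const_mul _).mul
        (h.measurable_fading_apply j (t + 1)).coe_nnreal_ennreal))
  calc ∫⁻ ω, expNeg (c₁ * interference l X F t ω + c₂ * interference l X F (t + 1) ω) ∂P
      = ∫⁻ ω, ⨅ n, ∏ j ∈ Finset.range n, expNeg (c₁ * l ‖X j ω t‖ * F j ω t +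
          c₂ * l ‖X j ω (t + 1)‖ * F j ω (t + 1)) ∂P := by
        refine lintegral_congr fun ω => ?_
        rw [← expNeg_tsum, interference, interference, ← ENNReal.tsum_mul_left,
          ← ENNReal.tsum_mul_left, ← ENNReal.tsum_add]
        simp_rw [mul_assoc]
    _ = ⨅ n, ∫⁻ ω, ∏ j ∈ Finset.range n, g (X j ω 0) ∂P := by
        rw [lintegral_iInf_prod hXF fun j ω => expNeg_le_one _]
        exact iInf_congr fun n => (h.lintegral_prod_expNeg_position_fading hl t c₁ c₂ n).trans
          (h.lintegral_prod_trajectory hφ' n)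
    _ = expNeg (Λ * ∫⁻ x, (1 - g x)) := by
        rw [← lintegral_iInf_prod (a := fun j ω => g (X j ω 0)) (fun j => hg.comp (hX0 j))
          fun j ω => hg1 _]
        exact h.lintegral_prod_initial hg hg1
    _ = _ := by rw [step4]

end IsMobileNetwork

end Network

/-! ### Level-crossing probabilities under Rayleigh fading -/

lemma expMeasure_Ioi {μ : ℝ} (hμ : 0 < μ) {a : ℝ} (ha : 0 ≤ a) :
    expMeasure μ (Set.Ioi a) = ENNReal.ofReal (Real.exp (-(μ * a))) := by
  have := isProbabilityMeasure_expMeasure hμ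
  have h1 : (expMeasure μ).real (Set.Iic a) = 1 - Real.exp (-(μ * a)) := by
    rw [← cdf_eq_real, cdf_expMeasure_eq hμ, if_pos ha]
  rw [← Set.compl_Iic, ← ofReal_measureReal, probReal_compl_eq_one_sub measurableSet_Iic, h1]
  congr 1
  ring

/-- The extreme denominators agree too: for `D = 0` both sides say `g > 0`, and for `D = ∞` both
fail because `T > 0`. Hence almost sure finiteness of the interference is not needed. -/
lemma lt_mul_div_iff {T c : ℝ≥0} (hT : 0 < T) (hc : 0 < c) (g D : ℝ≥0∞) :
    (T : ℝ≥0∞) < c * g / D ↔ T / c * D < g := by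
  have hc0 : (c : ℝ≥0∞) ≠ 0 := by simpa using hc.ne'
  have hT0 : (T : ℝ≥0∞) ≠ 0 := by simpa using hT.ne'
  rw [ENNReal.lt_div_iff_mul_lt (Or.inr ENNReal.coe_ne_top) (Or.inr hT0), mul_comm (c : ℝ≥0∞),
    ← ENNReal.div_lt_iff (Or.inl hc0) (Or.inl ENNReal.coe_ne_top)]
  rw [div_eq_mul_inv, div_eq_mul_inv, mul_right_comm]

/-- Isotropic path losses are integrable over the plane. -/
lemma IsPathLoss.lintegral_norm_ne_top {l : ℝ → ℝ≥0} (hl : IsPathLoss l) :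
    ∫⁻ x : Plane, l ‖x‖ ≠ ∞ := by
  have h1 : Integrable (fun x : Plane => (l ‖x‖ : ℝ)) := by
    -- Polar coordinates: in dimension 2 the radial weight is r.
    rw [integrable_fun_norm_addHaar (volume : Measure Plane) (f := fun r => (l r : ℝ))]
    simpa using hl.integrable
  simpa [HasFiniteIntegral, enorm] using h1.2.ne

section Network

variable {Ω : Type*} [MeasurableSpace Ω] {P : Measure Ω} {Λ : ℝ≥0}
  {K : Kernel Plane Trajectory} {μ : ℝ} {X : ℕ → Ω → Trajectory} {F : ℕ → Ω → ℝ≥0 → ℝ≥0}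
  {G : Ω → ℝ≥0 → ℝ≥0}

namespace IsMobileNetwork

lemma measure_lt_useful (h : IsMobileNetwork P Λ K μ X F G) (hμ : 0 < μ) (t : ℝ≥0) (a : ℝ≥0∞) :
    P {ω | a < G ω t} = expNeg (ENNReal.ofReal μ * a) := by
  rcases eq_or_ne a ∞ with rfl | ha
  · simp [ENNReal.mul_top, hμ]
  · lift a to ℝ≥0 using ha
    have h1 := (h.rayleigh t).measure_eq (p := fun x => (a : ℝ) < x) measurableSet_Ioi
    have h2 : {ω | (a : ℝ≥0∞) < G ω t} = {ω | (a : ℝ) < G ω t} := by ext; simp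
    rw [h2, h1, ← ENNReal.ofReal_coe_nnreal (p := a), ← ENNReal.ofReal_mul hμ.le,
      expNeg_ofReal (by positivity), ← expMeasure_Ioi hμ a.coe_nonneg]
    rfl

lemma measurable_useful_apply (h : IsMobileNetwork P Λ K μ X F G) (t : ℝ≥0) :
    Measurable fun ω => G ω t := (measurable_pi_apply t).comp h.measurable_useful

lemma measure_lt_useful_inter (h : IsMobileNetwork P Λ K μ X F G) (hμ : 0 < μ) (t : ℝ≥0)
    (a b : ℝ≥0∞) :
    P ({ω | a < G ω t} ∩ {ω | b < G ω (t + 1)}) =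
      expNeg (ENNReal.ofReal μ * a) * expNeg (ENNReal.ofReal μ * b) := by
  have hm : ∀ c : ℝ≥0∞, MeasurableSet {u : ℝ≥0 | c < u} := fun c =>
    measurableSet_lt measurable_const measurable_coe_nnreal_ennreal
  have := (h.indep_useful_step t).measure_inter_preimage_eq_mul _ _ (hm a) (hm b)
  rw [← h.measure_lt_useful hμ t, ← h.measure_lt_useful hμ (t + 1)]
  exact this

lemma measurable_interference (h : IsMobileNetwork P Λ K μ X F G) {l : ℝ → ℝ≥0}
    (hl : Measurable l) (t : ℝ≥0) : Measurable (interference l X F t) :=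
  Measurable.tsum fun j => (hl.comp
    ((measurable_pi_apply t).comp (h.measurable_position j)).norm).coe_nnreal_ennreal.mul
      (h.measurable_fading_apply j t).coe_nnreal_ennreal

lemma measurableSet_levelCrossing (h : IsMobileNetwork P Λ K μ X F G) {l : ℝ → ℝ≥0}
    (hl : Measurable l) (R : ℝ) (γ T t : ℝ≥0) :
    MeasurableSet (levelCrossing l R γ T X F G t) :=
  measurableSet_lt measurable_const
    (((h.measurable_useful_apply t).coe_nnreal_ennreal.const_mul _).div
      ((h.measurable_interference hl t).add_const _))

/-- Conditioning on the interference turns an event on the useful link into an expectation. -/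
lemma measure_useful_mem [IsProbabilityMeasure P] (h : IsMobileNetwork P Λ K μ X F G)
    {A : Set ((ℝ≥0 → ℝ≥0) × ((ℕ → Trajectory) × (ℕ → ℝ≥0 → ℝ≥0)))} (hA : MeasurableSet A) :
    P {ω | (G ω, (fun j => X j ω, fun j => F j ω)) ∈ A} =
      ∫⁻ ω, P {ω' | (G ω', (fun j => X j ω, fun j => F j ω)) ∈ A} ∂P := by
  have hG := h.measurable_useful
  have hXF := h.measurable_positions.prodMk h.measurable_fadings
  have h1 := h.lintegral_comp_useful (measurable_one.indicator hA)
  have h2 := lintegral_indicator_one (μ := P) (hA.preimage (hG.prodMk hXF))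
  refine h2.symm.trans (h1.trans (lintegral_congr fun ω => ?_))
  exact lintegral_indicator_one (μ := P) (hA.preimage (hG.prodMk measurable_const))

lemma measurableSet_crossing {l : ℝ → ℝ≥0} (hl : Measurable l) (R : ℝ) (γ T t : ℝ≥0) :
    MeasurableSet {q : (ℝ≥0 → ℝ≥0) × ((ℕ → Trajectory) × (ℕ → ℝ≥0 → ℝ≥0)) |
      (T : ℝ≥0∞) < l R * q.1 t / (totalInterference l q.2.1 q.2.2 t + γ)} := by
  have h1 : Measurable fun q : (ℝ≥0 → ℝ≥0) × ((ℕ → Trajectory) × (ℕ → ℝ≥0 → ℝ≥0)) => q.1 t := by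
    fun_prop
  exact measurableSet_lt measurable_const ((h1.coe_nnreal_ennreal.const_mul _).div
    (((measurable_totalInterference hl t).comp measurable_snd).add_const _))

/-- Rayleigh fading turns the probability of a level crossing into a Laplace transform. -/
lemma measure_levelCrossing [IsProbabilityMeasure P] (h : IsMobileNetwork P Λ K μ X F G)
    (hμ : 0 < μ) {l : ℝ → ℝ≥0} (hl : Measurable l) {R : ℝ} (hlR : 0 < l R) (γ : ℝ≥0) {T : ℝ≥0}
    (hT : 0 < T) (t : ℝ≥0) :
    P (levelCrossing l R γ T X F G t) =
      ∫⁻ ω, expNeg (ENNReal.ofReal μ * (T / l R * (interference l X F t ω + γ))) ∂P := by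
  refine (h.measure_useful_mem (measurableSet_crossing hl R γ T t)).trans
    (lintegral_congr fun ω => ?_)
  rw [← h.measure_lt_useful hμ t]
  congr 1
  ext ω'
  exact lt_mul_div_iff hT hlR _ _

lemma measure_levelCrossing_inter [IsProbabilityMeasure P] (h : IsMobileNetwork P Λ K μ X F G)
    (hμ : 0 < μ) {l : ℝ → ℝ≥0} (hl : Measurable l) {R : ℝ} (hlR : 0 < l R) (γ : ℝ≥0) {T : ℝ≥0}
    (hT : 0 < T) (t : ℝ≥0) :
    P (levelCrossing l R γ T X F G t ∩ levelCrossing l R γ T X F G (t + 1)) =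
      ∫⁻ ω, expNeg (ENNReal.ofReal μ * (T / l R * (interference l X F t ω + γ))) *
        expNeg (ENNReal.ofReal μ * (T / l R * (interference l X F (t + 1) ω + γ))) ∂P := by
  refine (h.measure_useful_mem ((measurableSet_crossing hl R γ T t).inter
    (measurableSet_crossing hl R γ T (t + 1)))).trans (lintegral_congr fun ω => ?_)
  rw [← h.measure_lt_useful_inter hμ t]
  congr 1
  ext ω'
  exact and_congr (lt_mul_div_iff hT hlR _ _)
    (lt_mul_div_iff hT hlR _ _)

end IsMobileNetwork

/-! ### Marginals of the two-time position measure -/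

/-- The position at time `t + 1` of points that start with uniform density has uniform density. -/
lemma lintegral_compProd_snd {K : Kernel Plane Trajectory} [IsMarkovKernel K]
    (hK : PreservesHomogeneity K) {t : ℝ≥0} {p : Kernel Plane Plane} [IsMarkovKernel p]
    (hp : RepresentsMotion K t p) {f : Plane → ℝ≥0∞} (hf : Measurable f) :
    ∫⁻ z, f z.2 ∂((volume : Measure Plane).compProd p) = ∫⁻ y, f y := by
  have h1 : Measurable fun w : Trajectory => (w t, w (t + 1)) := by fun_prop
  have h2 : Measurable fun w : Trajectory => w (t + 1) := by fun_prop
  rw [← show _ = _ from hp, lintegral_map (f := fun z : Plane × Plane => f z.2)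
    (hf.comp measurable_snd) h1]
  conv_rhs => rw [← hK (t + 1), lintegral_map hf h2]

lemma lintegral_compProd_fst {p : Kernel Plane Plane} [IsMarkovKernel p] {f : Plane → ℝ≥0∞}
    (hf : Measurable f) :
    ∫⁻ z, f z.1 ∂((volume : Measure Plane).compProd p) = ∫⁻ x, f x := by
  rw [Measure.lintegral_compProd (f := fun z : Plane × Plane => f z.1) (hf.comp measurable_fst)]
  simp

/-- Expansion of (1-a)(1-b), arranged as sums because subtraction is truncated. The product term
becomes the excess D that yields positive correlation. -/
lemma one_sub_add_one_sub {a b : ℝ≥0∞} (ha : a ≤ 1) (hb : b ≤ 1) :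
    (1 - a) + (1 - b) = (1 - a * b) + (1 - a) * (1 - b) := by
  have ha' : a ≠ ∞ := (ha.trans_lt ENNReal.one_lt_top).ne
  have hb' : b ≠ ∞ := (hb.trans_lt ENNReal.one_lt_top).ne
  lift a to ℝ≥0 using ha'
  lift b to ℝ≥0 using hb'
  have ha1 : a ≤ 1 := by exact_mod_cast ha
  have hb1 : b ≤ 1 := by exact_mod_cast hb
  have key : (1 - a) + (1 - b) = (1 - a * b) + (1 - a) * (1 - b) := by
    rw [← NNReal.coe_inj]
    push_cast [NNReal.coe_sub ha1, NNReal.coe_sub hb1, NNReal.coe_sub (mul_le_one' ha1 hb1)]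
    ring
  exact_mod_cast key

end Network

/-! ### Comparison of the joint and the marginal probabilities -/

theorem mainTheorem9 {Ω : Type*} [MeasurableSpace Ω] (P : Measure Ω) [IsProbabilityMeasure P]
    (Λ : ℝ≥0) (hΛ : 0 < Λ) (μ : ℝ) (hμ : 0 < μ)
    (l : ℝ → ℝ≥0) (hl : IsPathLoss l) (R : ℝ) (hR : 0 < R) (hlR : 0 < l R)
    (γ T : ℝ≥0) (hT : 0 < T)
    (K : Kernel Plane Trajectory) [IsMarkovKernel K] (hK : PreservesHomogeneity K)
    (X : ℕ → Ω → Trajectory) (F : ℕ → Ω → ℝ≥0 → ℝ≥0) (G : Ω → ℝ≥0 → ℝ≥0)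
    (hnet : IsMobileNetwork P Λ K μ X F G)
    (t : ℝ≥0) (p : Kernel Plane Plane) [IsMarkovKernel p] (hp : RepresentsMotion K t p) :
    P (levelCrossing l R γ T X F G (t + 1)) = P (levelCrossing l R γ T X F G t) ∧
    (0 < ∫⁻ x : Plane, ∫⁻ y : Plane, (l ‖x‖ : ℝ≥0∞) * (l ‖y‖ : ℝ≥0∞) ∂(p x) →
      P (levelCrossing l R γ T X F G (t + 1)) <
        P[levelCrossing l R γ T X F G (t + 1) | levelCrossing l R γ T X F G t]) := by
  have hlm := hl.measurable
  have := hnet.isProbabilityMeasure_fadingLaw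
  have hmean := hnet.mean_fadingLaw
  set ρ := fadingLaw P F
  set L₀ := levelCrossing l R γ T X F G t with hL₀
  set L₁ := levelCrossing l R γ T X F G (t + 1) with hL₁
  let c : ℝ≥0∞ := ENNReal.ofReal μ * (T / l R)
  have hlR0 : (l R : ℝ≥0∞) ≠ 0 := by simpa using hlR.ne'
  have hc0 : c ≠ 0 := by
    refine mul_ne_zero (by simpa using hμ) (ENNReal.div_pos ?_ ENNReal.coe_ne_top).ne'
    simpa using hT.ne'
  have hcT : c ≠ ∞ :=
    ENNReal.mul_ne_top ENNReal.ofReal_ne_top (ENNReal.div_ne_top ENNReal.coe_ne_top hlR0)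
  -- The noise contributes this deterministic factor once per time, so it cancels in the comparison.
  let e : ℝ≥0∞ := expNeg (c * γ)
  have he : e ≠ 0 := (expNeg_pos (ENNReal.mul_ne_top hcT ENNReal.coe_ne_top)).ne'
  have heT : e ≠ ∞ := expNeg_ne_top _
  have hexp : ∀ I : ℝ≥0∞,
      expNeg (ENNReal.ofReal μ * (T / l R * (I + γ))) = e * expNeg (c * I) := by
    intro I
    rw [← expNeg_add]
    congr 1
    simp only [c]
    ring
  let ψ : Plane → ℝ≥0∞ := fun x => laplace ρ (c * l ‖x‖)
  have hψm : Measurable ψ :=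
    measurable_laplace.comp ((hlm.comp measurable_norm).coe_nnreal_ennreal.const_mul _)
  have hψ1 : ∀ x, ψ x ≤ 1 := fun x => laplace_le_one _
  have hψm' : Measurable fun x => 1 - ψ x := measurable_const.sub hψm
  let a : ℝ≥0∞ := ∫⁻ x, (1 - ψ x)
  have haT : a ≠ ∞ := by
    have h1 : a ≤ ∫⁻ x : Plane, c * l ‖x‖ :=
      lintegral_mono fun x => one_sub_laplace_le hmean _
    have h2 : Measurable fun x : Plane => (l ‖x‖ : ℝ≥0∞) :=
      (hlm.comp measurable_norm).coe_nnreal_ennreal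
    rw [lintegral_const_mul _ h2] at h1
    exact (h1.trans_lt (ENNReal.mul_lt_top hcT.lt_top hl.lintegral_norm_ne_top.lt_top)).ne
  have hI : ∀ s, Measurable fun ω => c * interference l X F s ω :=
    fun s => (hnet.measurable_interference hlm s).const_mul c
  have hexpI : ∀ s, Measurable fun ω => expNeg (c * interference l X F s ω) :=
    fun s => measurable_expNeg.comp (hI s)
  have hexpI₂ : Measurable fun ω =>
      expNeg (c * interference l X F t ω + c * interference l X F (t + 1) ω) :=
    measurable_expNeg.comp ((hI t).add (hI (t + 1)))
  have hP₀ : P L₀ = e * expNeg (Λ * a) := by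
    rw [hL₀, hnet.measure_levelCrossing hμ hlm hlR γ hT t]
    simp_rw [hexp]
    rw [lintegral_const_mul _ (hexpI t)]
    -- A zero parameter removes the other time from the joint transform.
    have h1 := hnet.lintegral_expNeg_interference hlm hp c 0
    simp only [zero_mul, add_zero, laplace_zero, mul_one] at h1
    rw [h1]
    congr 3
    exact lintegral_compProd_fst hψm'
  have hP₁ : P L₁ = e * expNeg (Λ * a) := by
    rw [hL₁, hnet.measure_levelCrossing hμ hlm hlR γ hT (t + 1)]
    simp_rw [hexp]
    rw [lintegral_const_mul _ (hexpI (t + 1))]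
    have h1 := hnet.lintegral_expNeg_interference hlm hp 0 c
    simp only [zero_mul, zero_add, laplace_zero, one_mul] at h1
    rw [h1]
    congr 3
    exact lintegral_compProd_snd hK hp hψm'
  let J : ℝ≥0∞ := ∫⁻ z : Plane × Plane, (1 - ψ z.1 * ψ z.2) ∂((volume : Measure Plane).compProd p)
  let D : ℝ≥0∞ :=
    ∫⁻ z : Plane × Plane, (1 - ψ z.1) * (1 - ψ z.2) ∂((volume : Measure Plane).compProd p)
  have hP₀₁ : P (L₀ ∩ L₁) = e * e * expNeg (Λ * J) := by
    rw [hL₀, hL₁, hnet.measure_levelCrossing_inter hμ hlm hlR γ hT t]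
    simp_rw [hexp]
    rw [← hnet.lintegral_expNeg_interference hlm hp c c, ← lintegral_const_mul _ hexpI₂]
    refine lintegral_congr fun ω => ?_
    rw [expNeg_add]
    ring
  refine ⟨hP₁.trans hP₀.symm, fun hpos => ?_⟩
  have hD : D ≠ 0 := by
    intro hD0
    have hm : Measurable fun z : Plane × Plane => (1 - ψ z.1) * (1 - ψ z.2) :=
      (hψm'.comp measurable_fst).mul (hψm'.comp measurable_snd)
    have hml : Measurable fun z : Plane × Plane => (l ‖z.1‖ : ℝ≥0∞) * l ‖z.2‖ :=
      (hlm.comp measurable_fst.norm).coe_nnreal_ennreal.mul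
        (hlm.comp measurable_snd.norm).coe_nnreal_ennreal
    have h0 := (lintegral_eq_zero_iff hm).1 hD0
    rw [← Measure.lintegral_compProd (f := fun z : Plane × Plane => (l ‖z.1‖ : ℝ≥0∞) * l ‖z.2‖) hml]
      at hpos
    refine hpos.ne' ((lintegral_eq_zero_iff hml).2 ?_)
    filter_upwards [h0] with z hz
    have hzero : ∀ x, 1 - ψ x = 0 → (l ‖x‖ : ℝ≥0∞) = 0 := by
      intro x hx
      by_contra hne
      exact one_sub_laplace_pos hmean (mul_ne_zero hc0 hne) hx
    rcases mul_eq_zero.1 hz with h | h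
    · simp [hzero _ h]
    · simp [hzero _ h]
  have hJD : J + D = a + a := by
    have hm : Measurable fun z : Plane × Plane => 1 - ψ z.1 * ψ z.2 :=
      measurable_const.sub ((hψm.comp measurable_fst).mul (hψm.comp measurable_snd))
    rw [← lintegral_add_left hm]
    simp_rw [← one_sub_add_one_sub (hψ1 _) (hψ1 _)]
    have hm₁ : Measurable fun z : Plane × Plane => 1 - ψ z.1 := hψm'.comp measurable_fst
    rw [lintegral_add_left hm₁]
    congr 1
    · exact lintegral_compProd_fst hψm'
    · exact lintegral_compProd_snd hK hp hψm'
  have hJ : J < a + a := by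
    rw [← hJD]
    refine ENNReal.lt_add_right ?_ hD
    -- Strictness needs J finite, which follows from J ≤ 2a < ∞.
    exact ((le_self_add.trans hJD.le).trans_lt (ENNReal.add_lt_top.2 ⟨haT.lt_top, haT.lt_top⟩)).ne
  have hΛ0 : (Λ : ℝ≥0∞) ≠ 0 := by simpa using hΛ.ne'
  have hlt : expNeg (Λ * a) * expNeg (Λ * a) < expNeg (Λ * J) := by
    rw [← expNeg_add, ← mul_add]
    exact strictAnti_expNeg (ENNReal.mul_lt_mul_right hΛ0 ENNReal.coe_ne_top hJ)
  have hP0 : P L₀ ≠ 0 := by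
    rw [hP₀]
    exact mul_ne_zero he (expNeg_pos (ENNReal.mul_ne_top ENNReal.coe_ne_top haT)).ne'
  rw [cond_apply (hnet.measurableSet_levelCrossing hlm R γ T t), mul_comm, ← div_eq_mul_inv,
    ENNReal.lt_div_iff_mul_lt (Or.inl hP0) (Or.inl (measure_ne_top P L₀)), hP₀₁, hP₁, hP₀]
  calc e * expNeg (Λ * a) * (e * expNeg (Λ * a))
      = e * e * (expNeg (Λ * a) * expNeg (Λ * a)) := by ring
    _ < e * e * expNeg (Λ * J) :=
        ENNReal.mul_lt_mul_right (mul_ne_zero he he) (ENNReal.mul_ne_top heT heT) hlt
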